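/- Let $n\ge 0$ be an integer and let $\Gamma$ be a simple contour in $\mathbb{C}$, that is, a locally rectifiable curve, closed or not, bounded or unbounded, without self-intersections (apart from coinciding endpoints when it is closed), given by a locally absolutely continuous parametrization on an interval. For $1\le i\le n$ let $p_i,f_i$ be functions analytic in a neighborhood of $0$ with $p_i(0)=f_i(0)=1$, and let $q_i,g_i$ be continuous functions on $\Gamma$ with $\int_\Gamma|q_i(u)|^2|du|<\infty$ and $\int_\Gamma|g_i(u)|^2|du|<\infty$. Let $H(v,u)$ be a function such that for every $u\in\Gamma$ the function $v\mapsto H(v,u)$ is analytic at $v=0$ and $$\oint_0\frac{f_i(v)}{v^i}\,H(v,u)\,\frac{dv}{2\pi\mathrm{i}}=g_i(u)\qquad\text{for all }1\le i\le n,\ u\in\Gamma,$$ where $\oint_0$ denotes integration over a sufficiently small positively oriented circle around $0$. Set $P_1(v)=p_1(v)$ and $P_i(v)=p_i(v)/p_{i-1}(v)$ for $2\le i\le n$, and $$K(u_1,u_2)=\sum_{\ell=1}^n q_\ell(u_1)\oint\frac{dv_1}{2\pi\mathrm{i}}\cdots\oint\frac{dv_\ell}{2\pi\mathrm{i}}\;\frac{H(v_1,u_2)}{\left[\prod_{i=1}^{\ell-1}(v_i-v_{i+1})\right]\cdot\left[\prod_{i=1}^{\ell}v_iP_i(v_i)\right]},\qquad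 u_1,u_2\in\Gamma,$$ where the contours are nested, sufficiently small positively oriented circles around $0$ with $|v_1|>|v_2|>\cdots>|v_\ell|$. Then $$(K\varphi)(u_1)=\int_\Gamma K(u_1,u_2)\,\varphi(u_2)\,\frac{du_2}{2\pi\mathrm{i}}$$ defines a bounded operator on $L^2(\Gamma,|du|)$, this operator is trace class, and its Fredholm determinant satisfies $$\det\left[\oint_0 v^{i-j-1}p_i(v)f_j(v)\,\frac{dv}{2\pi\mathrm{i}}+\int_\Gamma q_i(u)g_j(u)\,\frac{du}{2\pi\mathrm{i}}\right]_{i,j=1}^n=\det(\mathrm{I}+K).$$ -/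

import Mathlib

open MeasureTheory Filter Topology

noncomputable section

/-- A simple contour in the complex plane: an interval `dom` of the real line (open, closed or
half-open, bounded or unbounded) together with a locally absolutely continuous parametrization
(every piecewise `C¹` curve is one, and so is every locally rectifiable curve parametrized by
arc length) which is either injective, or a closed curve that is injective up to the
coincidence of its two endpoints. Only the values of `toFun` on `dom` matter. -/
structure SimpleContour where
  toFun : ℝ → ℂ
  dom : Set ℝ
  ordConnected : dom.OrdConnected
  nontrivial : dom.Nontrivial
  locallyAC : ∀ a ∈ dom, ∀ b ∈ dom, AbsolutelyContinuousOnInterval toFun a b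
  simple : Set.InjOn toFun dom ∨
    ∃ a b : ℝ, a < b ∧ dom = Set.Icc a b ∧ toFun a = toFun b ∧ Set.InjOn toFun (Set.Ico a b)

namespace SimpleContour

/-- The set of points of the contour. -/
def carrier (Γ : SimpleContour) : Set ℂ := Γ.toFun '' Γ.dom

/-- The arc length measure `|du|` on the contour, as a measure on `ℂ`. -/
def arcLength (Γ : SimpleContour) : Measure ℂ :=
  ((volume.restrict Γ.dom).withDensity fun t => ‖deriv Γ.toFun t‖ₑ).map Γ.toFun

/-- `h` is integrable along the contour with respect to `du`. -/
def ContourIntegrable (Γ : SimpleContour) (h : ℂ → ℂ) : Prop :=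
  IntegrableOn (fun t => h (Γ.toFun t) * deriv Γ.toFun t) Γ.dom

/-- The normalized contour integral `∫_Γ h(u) du / (2πi)`. -/
def integral (Γ : SimpleContour) (h : ℂ → ℂ) : ℂ :=
  (2 * Real.pi * Complex.I)⁻¹ * ∫ t in Γ.dom, h (Γ.toFun t) * deriv Γ.toFun t

/-- The bounded operator `T` on `L²(Γ, |du|)` is the integral operator with kernel `K` with
respect to `du / (2πi)`: for every `φ` in `L²`, for almost every `u₁`, the function
`u₂ ↦ K(u₁, u₂) φ(u₂)` is integrable along `Γ` and
`(T φ)(u₁) = ∫_Γ K(u₁, u₂) φ(u₂) du₂ / (2πi)`. -/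
def HasKernel (Γ : SimpleContour) (K : ℂ → ℂ → ℂ)
    (T : Lp ℂ 2 Γ.arcLength →L[ℂ] Lp ℂ 2 Γ.arcLength) : Prop :=
  ∀ φ : Lp ℂ 2 Γ.arcLength, ∀ᵐ u₁ ∂Γ.arcLength,
    Γ.ContourIntegrable (fun u₂ => K u₁ u₂ * φ u₂) ∧
      T φ u₁ = Γ.integral fun u₂ => K u₁ u₂ * φ u₂

end SimpleContour

/-- The normalized integral `∮₀ F(v) dv / (2πi)` over a small positively oriented circle around
the origin: the limit of the integrals over `|v| = r` as `r` decreases to `0`. For `F` holomorphic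
in a punctured neighborhood of `0` the integral does not depend on `r` once `r` is small. -/
def smallCircleIntegral (F : ℂ → ℂ) : ℂ :=
  limUnder (𝓝[>] (0 : ℝ)) fun r => (2 * Real.pi * Complex.I)⁻¹ * ∮ v in C(0, r), F v

/-- The tuples `r` of radii of nested circles, the first circle being the outermost one. -/
def nestedRadii (l : ℕ) : Set (Fin l → ℝ) := {r | (∀ i, 0 < r i) ∧ StrictAnti r}

/-- The normalized `l`-fold integral
`∮ dv₁ / (2πi) ⋯ ∮ dv_l / (2πi) F(v₁, …, v_l)` over nested small circles around the origin with
`|v₁| > |v₂| > ⋯ > |v_l|`: the limit of the integrals over the tori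
`|v₁| = r₁, …, |v_l| = r_l` as the nested radii `r₁ > ⋯ > r_l > 0` tend to `0`. For the integrands
used here the integral does not depend on the nested radii once these are small. -/
def nestedCircleIntegral {l : ℕ} (F : (Fin l → ℂ) → ℂ) : ℂ :=
  limUnder (𝓝[nestedRadii l] (0 : Fin l → ℝ)) fun r =>
    ((2 * Real.pi * Complex.I) ^ l)⁻¹ * ∯ v in T(0, r), F v

/-- `P₁ = p₁`, and `P_i = p_i / p_{i-1}` for `i ≥ 2`. -/
def ratioFun (p : ℕ → ℂ → ℂ) (i : ℕ) (v : ℂ) : ℂ :=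
  if i = 1 then p 1 v else p i v / p (i - 1) v

/-- The integrand
`h(v₁) / ([∏_{i=1}^{l-1} (v_i - v_{i+1})] [∏_{i=1}^{l} v_i P_i(v_i)])`; the variable `v_{i+1}` of
the formula is `v i`, for `i = 0, …, l - 1`. -/
def kernelIntegrand (p : ℕ → ℂ → ℂ) (h : ℂ → ℂ) (l : ℕ) (hl : 0 < l) (v : Fin l → ℂ) : ℂ :=
  h (v ⟨0, hl⟩) /
    ((∏ i : Fin (l - 1), (v ⟨i, by omega⟩ - v ⟨i + 1, by omega⟩)) *
      ∏ i : Fin l, v i * ratioFun p (i + 1) (v i))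

/-- The kernel
`K(u₁, u₂) = ∑_{l=1}^n q_l(u₁) ∮ dv₁/(2πi) ⋯ ∮ dv_l/(2πi)
  H(v₁, u₂) / ([∏_{i=1}^{l-1} (v_i - v_{i+1})] [∏_{i=1}^{l} v_i P_i(v_i)])`;
the summation variable `l` of the formula is `l + 1` in the code. -/
def contourKernel (n : ℕ) (p q : ℕ → ℂ → ℂ) (H : ℂ → ℂ → ℂ) (u₁ u₂ : ℂ) : ℂ :=
  ∑ l ∈ Finset.range n, q (l + 1) u₁ *
    nestedCircleIntegral (kernelIntegrand p (fun v => H v u₂) (l + 1) l.succ_pos)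

/-- The matrix
`[∮₀ v^{i-j-1} p_i(v) f_j(v) dv/(2πi) + ∫_Γ q_i(u) g_j(u) du/(2πi)]_{i,j=1}^n`; the row and
column indices of the formula are `i + 1` and `j + 1`. -/
def contourMatrix (n : ℕ) (Γ : SimpleContour) (p f q g : ℕ → ℂ → ℂ) :
    Matrix (Fin n) (Fin n) ℂ :=
  Matrix.of fun i j =>
    smallCircleIntegral
        (fun v => v ^ (((i : ℤ) + 1) - ((j : ℤ) + 1) - 1) * p (i + 1) v * f (j + 1) v) +
      Γ.integral (fun u => q (i + 1) u * g (j + 1) u)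

universe u

/-- `T` is a trace class operator on the Hilbert space `E`: the trace
`∑ᵢ ⟨eᵢ, |T| eᵢ⟩` of `|T| = (T* T)^{1/2}` converges in every orthonormal basis. -/
def IsTraceClass {E : Type u} [NormedAddCommGroup E] [InnerProductSpace ℂ E] [CompleteSpace E]
    (T : E →L[ℂ] E) : Prop :=
  ∀ (ι : Type u) (b : HilbertBasis ι ℂ E), Summable fun i => inner ℂ (b i) (CFC.abs T (b i))

open scoped Classical in
/-- `d` is the Fredholm determinant `det(I + T)` of the (trace class) operator `T`: in every
orthonormal basis, the determinants of the finite sections of `I + T` converge to `d`. Every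
trace class operator has exactly one Fredholm determinant in this sense. -/
def HasFredholmDet {E : Type u} [NormedAddCommGroup E] [InnerProductSpace ℂ E]
    (T : E →L[ℂ] E) (d : ℂ) : Prop :=
  ∀ (ι : Type u) (b : HilbertBasis ι ℂ E),
    Tendsto (fun s : Finset ι =>
      (1 + Matrix.of fun i j : s => inner ℂ (b i) (T (b j)) : Matrix s s ℂ).det) atTop (𝓝 d)

end

/-! For fixed `u` on the contour, expand `h = H(·, u)` near `0` along the functions `v^k
p_{k+1}(v)`: `h(v) = ∑_{k<n} c_k(u) v^k p_{k+1}(v) + O(v^n)`. Everything follows from two readings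
of the coefficients `c_k`.

They are the nested integrals of the kernel. One Cauchy integral against `1 / (x (x - w) P(x))`
divides by `P`, subtracts the value at `0` and divides by the variable, which is exactly the step
from one remainder of the expansion to the next (`circleIntegral_div_mul_sub_eq_dslope`,
`nestedCircleIntegral_kernelIntegrand`).

They are also determined by the `g_j`. The `O(v^n)` term does not reach Taylor coefficients of order
below `n`, so the hypothesis on `H` reads `g = c A` for row vectors, where `A` is the residue part
of the matrix (`smallCircleIntegral_eq_sum_residueMatrix`). Since `A` is upper triangular with unit
diagonal, `c = g A⁻¹`.

Hence `K(u₁, u₂) = ∑_k q_{k+1}(u₁) (g A⁻¹)_k(u₂)` has finite rank with `L²` factors. With `B_ij =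
∫_Γ q_i g_j du/(2πi)`, its Fredholm determinant is `det(1 + B A⁻¹) = det(A + B)`, because `det A =
1`. -/

/-! ### Finite rank operators: trace class and Fredholm determinant -/

/-- A continuous operator with finite-dimensional range has a summable diagonal in every
orthonormal basis. -/
theorem HilbertBasis.summable_inner_apply_of_finiteDimensional_range {ι E : Type*}
    [NormedAddCommGroup E] [InnerProductSpace ℂ E] [CompleteSpace E] (b : HilbertBasis ι ℂ E)
    (S : E →L[ℂ] E) (V : Submodule ℂ E) [FiniteDimensional ℂ V] (hV : ∀ x, S x ∈ V) :
    Summable fun i => inner ℂ (b i) (S (b i)) := by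
  let e := stdOrthonormalBasis ℂ V
  have hS : ∀ x, S x = ∑ k, inner ℂ (S.adjoint (e k : E)) x • (e k : E) := by
    intro x
    have h := congrArg (Subtype.val) (e.sum_repr' ⟨S x, hV x⟩)
    simp only [Submodule.coe_sum, Submodule.coe_smul, Submodule.coe_inner] at h
    rw [← h]
    simp only [ContinuousLinearMap.adjoint_inner_left]
  have : (fun i => inner ℂ (b i) (S (b i))) =
      fun i => ∑ k, inner ℂ (S.adjoint (e k : E)) (b i) * inner ℂ (b i) (e k : E) := by
    funext i
    conv_lhs => rw [hS (b i)]
    simp only [inner_sum, inner_smul_right]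
  rw [this]
  exact summable_sum fun k _ => b.summable_inner_mul_inner _ _

/-- The finite rank operator `x ↦ ∑ k, F k x • a k`. -/
noncomputable def finiteRankOperator {E : Type*} [NormedAddCommGroup E] [InnerProductSpace ℂ E]
    {m : ℕ} (F : Fin m → E →L[ℂ] ℂ) (a : Fin m → E) : E →L[ℂ] E :=
  ∑ k, (F k).smulRight (a k)

theorem finiteRankOperator_apply {E : Type*} [NormedAddCommGroup E] [InnerProductSpace ℂ E]
    {m : ℕ} (F : Fin m → E →L[ℂ] ℂ) (a : Fin m → E) (x : E) :
    finiteRankOperator F a x = ∑ k, F k x • a k := by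
  simp [finiteRankOperator]

/-- Let `V` be spanned by the Riesz vectors of the functionals `F k`. On `Vᗮ` the operator `T`
vanishes, hence so does `|T|² = T* T`, and then `|T|` by self-adjointness. Self-adjointness also
turns this into the inclusion of the range of `|T|` in `Vᗮᗮ = V`, which has finite dimension. -/
theorem isTraceClass_finiteRankOperator {E : Type*} [NormedAddCommGroup E]
    [InnerProductSpace ℂ E] [CompleteSpace E] {m : ℕ} (F : Fin m → E →L[ℂ] ℂ) (a : Fin m → E) :
    IsTraceClass (finiteRankOperator F a) := by
  intro ι b
  set T := finiteRankOperator F a with hT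
  let y : Fin m → E := fun k => (InnerProductSpace.toDual ℂ E).symm (F k)
  let V : Submodule ℂ E := Submodule.span ℂ (Set.range y)
  have : FiniteDimensional ℂ V := FiniteDimensional.span_of_finite ℂ (Set.finite_range y)
  have hsa : ContinuousLinearMap.adjoint (CFC.abs T) = CFC.abs T :=
    (IsSelfAdjoint.of_nonneg (CFC.abs_nonneg T)).adjoint_eq
  have hker : ∀ z ∈ Vᗮ, CFC.abs T z = 0 := by
    intro z hz
    have hTz : T z = 0 := by
      rw [hT, finiteRankOperator_apply]
      refine Finset.sum_eq_zero fun k _ => ?_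
      have h1 : inner ℂ (y k) z = 0 :=
        (Submodule.mem_orthogonal _ _).1 hz _ (Submodule.subset_span ⟨k, rfl⟩)
      rw [InnerProductSpace.toDual_symm_apply] at h1
      rw [h1, zero_smul]
    have h2 : CFC.abs T (CFC.abs T z) = 0 := by
      have h3 := congrArg (fun A : E →L[ℂ] E => A z) (CFC.abs_mul_abs T)
      simpa [hTz] using h3
    rw [← inner_self_eq_zero (𝕜 := ℂ)]
    conv_lhs => rw [← hsa]
    rw [ContinuousLinearMap.adjoint_inner_left, hsa, h2, inner_zero_right]
  refine b.summable_inner_apply_of_finiteDimensional_range (CFC.abs T) V fun x => ?_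
  rw [← Submodule.orthogonal_orthogonal V]
  refine (Submodule.mem_orthogonal _ _).2 fun z hz => ?_
  rw [← hsa, ContinuousLinearMap.adjoint_inner_right, hker z hz, inner_zero_left]

-- The identity `det(1 + XY) = det(1 + YX)` replaces each finite section, whose size grows, by a
-- determinant of fixed size `m`. Its entries are `F k` applied to partial sums of the basis
-- expansion of `a l`, so continuity of `F k` gives the limit.
open scoped Classical in
theorem hasFredholmDet_finiteRankOperator {E : Type*} [NormedAddCommGroup E]
    [InnerProductSpace ℂ E] {m : ℕ} (F : Fin m → E →L[ℂ] ℂ) (a : Fin m → E) :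
    HasFredholmDet (finiteRankOperator F a) (1 + Matrix.of fun k l => F k (a l)).det := by
  intro ι b
  have h1 : ∀ s : Finset ι,
      (1 + Matrix.of fun i j : s => inner ℂ (b i) (finiteRankOperator F a (b j)) :
        Matrix s s ℂ).det =
      (1 + Matrix.of fun k l => ∑ i ∈ s, inner ℂ (b i) (a l) * F k (b i)).det := by
    intro s
    have h2 : (Matrix.of fun i j : s => inner ℂ (b i) (finiteRankOperator F a (b j))) =
        (Matrix.of fun (i : s) k => inner ℂ (b i) (a k)) *
          (Matrix.of fun k (j : s) => F k (b j)) := by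
      ext i j
      simp [Matrix.mul_apply, finiteRankOperator_apply, mul_comm]
    rw [h2, Matrix.det_one_add_mul_comm]
    congr 2
    ext k l
    simp only [Matrix.mul_apply, Matrix.of_apply]
    rw [Finset.sum_coe_sort s (fun i => F k (b i) * inner ℂ (b i) (a l))]
    exact Finset.sum_congr rfl fun _ _ => mul_comm _ _
  simp only [h1]
  refine (continuous_id.matrix_det.tendsto (1 + Matrix.of fun k l => F k (a l))).comp
    (tendsto_const_nhds.add ?_)
  refine tendsto_pi_nhds.2 fun k => tendsto_pi_nhds.2 fun l => ?_
  have h3 := (b.hasSum_repr (a l)).mapL (F k)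
  simpa [HilbertBasis.repr_apply_apply, HasSum] using h3

/-! ### Taylor coefficients at the origin as small circle integrals -/

/-- The `k`-th Taylor coefficient of `φ` at `0`. -/
noncomputable def taylorCoeffZero (k : ℕ) (φ : ℂ → ℂ) : ℂ := iteratedDeriv k φ 0 / k.factorial

theorem AnalyticAt.eventually_differentiableOn_closedBall {φ : ℂ → ℂ} (hφ : AnalyticAt ℂ φ 0) :
    ∀ᶠ r in 𝓝[>] (0 : ℝ), DifferentiableOn ℂ φ (Metric.closedBall 0 r) := by
  obtain ⟨δ, hδ, h⟩ := Metric.eventually_nhds_iff_ball.1 hφ.eventually_analyticAt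
  filter_upwards [Ioo_mem_nhdsGT hδ] with r hr z hz
  exact (h z (Metric.closedBall_subset_ball hr.2 hz)).differentiableAt.differentiableWithinAt

theorem eventually_circleIntegral_eq_taylorCoeffZero {φ F : ℂ → ℂ} {k : ℕ}
    (hφ : AnalyticAt ℂ φ 0) (hF : ∀ᶠ v in 𝓝[≠] (0 : ℂ), F v = φ v / v ^ (k + 1)) :
    ∀ᶠ r in 𝓝[>] (0 : ℝ),
      (2 * Real.pi * Complex.I)⁻¹ * (∮ v in C(0, r), F v) = taylorCoeffZero k φ := by
  rw [eventually_nhdsWithin_iff] at hF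
  obtain ⟨δ, hδ, h⟩ := Metric.eventually_nhds_iff_ball.1 hF
  filter_upwards [Ioo_mem_nhdsGT hδ, hφ.eventually_differentiableOn_closedBall] with r hr hd
  have h0 : 0 < r := hr.1
  have h1 : (∮ v in C(0, r), F v) = ∮ v in C(0, r), (1 / (v - 0) ^ (k + 1)) • φ v := by
    refine circleIntegral.integral_congr h0.le fun v hv => ?_
    have hv' : ‖v‖ = r := by simpa using hv
    have hv0 : v ≠ 0 := by
      rintro rfl
      simp at hv'
      exact h0.ne hv'
    simp only [h v (by simpa [hv'] using hr.2) hv0, sub_zero, smul_eq_mul]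
    ring
  rw [h1, hd.circleIntegral_one_div_sub_center_pow_smul h0, smul_eq_mul, taylorCoeffZero]
  have := Complex.two_pi_I_ne_zero
  field_simp

theorem smallCircleIntegral_eq_taylorCoeffZero {φ F : ℂ → ℂ} {k : ℕ}
    (hφ : AnalyticAt ℂ φ 0) (hF : ∀ᶠ v in 𝓝[≠] (0 : ℂ), F v = φ v / v ^ (k + 1)) :
    smallCircleIntegral F = taylorCoeffZero k φ :=
  (tendsto_const_nhds.congr' ((eventually_circleIntegral_eq_taylorCoeffZero hφ hF).mono
    fun _ h => h.symm)).limUnder_eq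

theorem taylorCoeffZero_congr {φ ψ : ℂ → ℂ} (k : ℕ) (h : φ =ᶠ[𝓝 0] ψ) :
    taylorCoeffZero k φ = taylorCoeffZero k ψ := by
  rw [taylorCoeffZero, taylorCoeffZero, h.iteratedDeriv_eq k]

theorem taylorCoeffZero_add {φ ψ : ℂ → ℂ} (k : ℕ) (hφ : AnalyticAt ℂ φ 0)
    (hψ : AnalyticAt ℂ ψ 0) :
    taylorCoeffZero k (fun v => φ v + ψ v) = taylorCoeffZero k φ + taylorCoeffZero k ψ := by
  simp only [taylorCoeffZero]
  rw [iteratedDeriv_fun_add hφ.contDiffAt hψ.contDiffAt, add_div]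

theorem taylorCoeffZero_const_mul {φ : ℂ → ℂ} (k : ℕ) (c : ℂ) :
    taylorCoeffZero k (fun v => c * φ v) = c * taylorCoeffZero k φ := by
  simp only [taylorCoeffZero]
  rw [iteratedDeriv_const_mul_field, mul_div_assoc]

theorem taylorCoeffZero_sum {ι : Type*} (s : Finset ι) {φ : ι → ℂ → ℂ} (k : ℕ)
    (hφ : ∀ i ∈ s, AnalyticAt ℂ (φ i) 0) :
    taylorCoeffZero k (fun v => ∑ i ∈ s, φ i v) = ∑ i ∈ s, taylorCoeffZero k (φ i) := by
  simp only [taylorCoeffZero]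
  rw [iteratedDeriv_fun_sum fun i hi => (hφ i hi).contDiffAt, Finset.sum_div]

/-- Off the origin both sides have the same Cauchy integrand `φ(v) / v^(k+1)`; this avoids the
Leibniz rule. -/
theorem taylorCoeffZero_pow_add_mul {φ : ℂ → ℂ} (k m : ℕ) (hφ : AnalyticAt ℂ φ 0) :
    taylorCoeffZero (k + m) (fun v => v ^ m * φ v) = taylorCoeffZero k φ := by
  have hF : ∀ᶠ v in 𝓝[≠] (0 : ℂ), φ v / v ^ (k + 1) = (v ^ m * φ v) / v ^ (k + m + 1) := by
    filter_upwards [self_mem_nhdsWithin] with v hv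
    have : v ≠ 0 := hv
    field_simp
    ring
  have ha : AnalyticAt ℂ (fun v => v ^ m * φ v) 0 := (analyticAt_id.pow m).mul hφ
  rw [← smallCircleIntegral_eq_taylorCoeffZero ha hF,
    smallCircleIntegral_eq_taylorCoeffZero hφ (Eventually.of_forall fun _ => rfl)]

theorem taylorCoeffZero_zero (φ : ℂ → ℂ) : taylorCoeffZero 0 φ = φ 0 := by
  simp [taylorCoeffZero]

theorem taylorCoeffZero_pow_mul_of_lt {φ : ℂ → ℂ} {k m : ℕ} (hkm : k < m)
    (hφ : AnalyticAt ℂ φ 0) : taylorCoeffZero k (fun v => v ^ m * φ v) = 0 := by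
  obtain ⟨d, rfl⟩ := Nat.exists_eq_add_of_lt hkm
  -- With `m = k + d + 1`, only `v^k` is stripped off; what remains is the value at `0` of `v^(d+1)
  -- φ(v)`.
  have h := taylorCoeffZero_pow_add_mul 0 k (φ := fun v => v ^ (d + 1) * φ v)
    ((analyticAt_id.pow (d + 1)).mul hφ)
  rw [zero_add, taylorCoeffZero_zero] at h
  simp only [ne_eq, Nat.add_eq_zero_iff, one_ne_zero, and_false, not_false_eq_true, zero_pow,
    zero_mul] at h
  rw [← h]
  congr 1
  funext v
  ring

/-! ### Expansion of an analytic function along `v^k p_{k+1}(v)` -/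

/-- The successive quotients `h₀ = h`, `h_{k+1}(v) = (h_k(v) / P_{k+1}(v) - (h_k / P_{k+1})(0)) / v`
in the expansion of `h` along `p₁, v p₂, v² p₃, …`. -/
noncomputable def ratioQuotient (p : ℕ → ℂ → ℂ) (h : ℂ → ℂ) : ℕ → ℂ → ℂ
  | 0 => h
  | k + 1 => dslope (fun v => ratioQuotient p h k v / ratioFun p (k + 1) v) 0

theorem AnalyticAt.dslope_self {φ : ℂ → ℂ} (hφ : AnalyticAt ℂ φ 0) :
    AnalyticAt ℂ (dslope φ 0) 0 := by
  obtain ⟨P, hP⟩ := hφ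
  exact ⟨_, hP.has_fpower_series_dslope_fslope⟩

section Expansion

variable {n : ℕ} {p : ℕ → ℂ → ℂ} {h : ℂ → ℂ}

theorem analyticAt_ratioFun (hp : ∀ i, 1 ≤ i → i ≤ n → AnalyticAt ℂ (p i) 0 ∧ p i 0 = 1) {k : ℕ}
    (hk : k < n) : AnalyticAt ℂ (ratioFun p (k + 1)) 0 ∧ ratioFun p (k + 1) 0 = 1 := by
  have h1 := hp (k + 1) (by omega) (by omega)
  by_cases h0 : k = 0
  · subst h0
    have : ratioFun p (0 + 1) = p 1 := by
      funext v
      simp [ratioFun]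
    rw [this]
    exact h1
  · have h2 := hp k (by omega) (by omega)
    have : ratioFun p (k + 1) = fun v => p (k + 1) v / p k v := by
      funext v
      simp [ratioFun, h0]
    rw [this]
    refine ⟨h1.1.div h2.1 (by simp [h2.2]), by simp [h1.2, h2.2]⟩

theorem analyticAt_ratioQuotient
    (hp : ∀ i, 1 ≤ i → i ≤ n → AnalyticAt ℂ (p i) 0 ∧ p i 0 = 1) (hh : AnalyticAt ℂ h 0) :
    ∀ k ≤ n, AnalyticAt ℂ (ratioQuotient p h k) 0
  | 0, _ => hh
  | k + 1, hk => by
    have h1 := analyticAt_ratioFun hp (k := k) (by omega)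
    exact ((analyticAt_ratioQuotient hp hh k (by omega)).div h1.1 (by simp [h1.2])).dslope_self

theorem ratioQuotient_eventuallyEq
    (hp : ∀ i, 1 ≤ i → i ≤ n → AnalyticAt ℂ (p i) 0 ∧ p i 0 = 1) {k : ℕ} (hk : k < n) :
    ∀ᶠ v in 𝓝 (0 : ℂ), ratioQuotient p h k v =
      ratioFun p (k + 1) v * (ratioQuotient p h k 0 + v * ratioQuotient p h (k + 1) v) := by
  have h1 := analyticAt_ratioFun hp hk
  filter_upwards [h1.1.continuousAt.eventually_ne (y := 0) (by simp [h1.2])] with v hv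
  have h2 := sub_smul_dslope (fun v => ratioQuotient p h k v / ratioFun p (k + 1) v) 0 v
  rw [sub_zero, smul_eq_mul] at h2
  rw [ratioQuotient, h2, h1.2]
  field_simp
  ring

/-- Iterates `h_k = P_{k+1} (h_k(0) + v h_{k+1})`, using that `P_1 ⋯ P_m` telescopes to `p_m`. The
case `m = 0` stands for the empty product, since `p 0` is arbitrary. -/
theorem eventually_eq_sum_ratioQuotient
    (hp : ∀ i, 1 ≤ i → i ≤ n → AnalyticAt ℂ (p i) 0 ∧ p i 0 = 1) (m : ℕ) (hm : m ≤ n) :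
    ∀ᶠ v in 𝓝 (0 : ℂ), h v = ∑ k ∈ Finset.range m,
        ratioQuotient p h k 0 * (v ^ k * p (k + 1) v) +
      v ^ m * ((if m = 0 then 1 else p m v) * ratioQuotient p h m v) := by
  induction m with
  | zero => exact Eventually.of_forall fun v => by simp [ratioQuotient]
  | succ m ih =>
    have h2 : ∀ᶠ v in 𝓝 (0 : ℂ), (if m = 0 then 1 else p m v) * ratioFun p (m + 1) v
        = p (m + 1) v := by
      by_cases h0 : m = 0
      · subst h0
        exact Eventually.of_forall fun v => by simp [ratioFun]
      · have h3 := hp m (by omega) (by omega)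
        filter_upwards [h3.1.continuousAt.eventually_ne (y := 0) (by simp [h3.2])] with v hv
        simp only [h0, if_false, ratioFun, Nat.add_eq_right, Nat.add_sub_cancel]
        field_simp
    filter_upwards [ih (by omega), h2, ratioQuotient_eventuallyEq (h := h) hp (k := m) (by omega)]
      with v h3 h4 h5
    rw [h3, Finset.sum_range_succ, h5]
    simp only [Nat.add_eq_zero_iff, one_ne_zero, and_false, if_false]
    rw [← h4]
    ring

theorem taylorCoeffZero_mul_eq_sum
    (hp : ∀ i, 1 ≤ i → i ≤ n → AnalyticAt ℂ (p i) 0 ∧ p i 0 = 1) (hh : AnalyticAt ℂ h 0)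
    {f : ℂ → ℂ} (hf : AnalyticAt ℂ f 0) {j : ℕ} (hj : j < n) :
    taylorCoeffZero j (fun v => f v * h v) = ∑ k ∈ Finset.range n,
      ratioQuotient p h k 0 * taylorCoeffZero j (fun v => v ^ k * (p (k + 1) v * f v)) := by
  have h0 : n ≠ 0 := by omega
  have hpf : ∀ k ∈ Finset.range n, AnalyticAt ℂ (fun v => v ^ k * (p (k + 1) v * f v)) 0 :=
    fun k hk => (analyticAt_id.pow k).mul
      ((hp (k + 1) (by omega) (by have := Finset.mem_range.1 hk; omega)).1.mul hf)
  have hr : AnalyticAt ℂ (fun v => p n v * ratioQuotient p h n v * f v) 0 :=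
    ((hp n (by omega) le_rfl).1.mul (analyticAt_ratioQuotient hp hh n le_rfl)).mul hf
  have h1 : (fun v => f v * h v) =ᶠ[𝓝 0] fun v =>
      (∑ k ∈ Finset.range n, ratioQuotient p h k 0 * (v ^ k * (p (k + 1) v * f v))) +
        v ^ n * (p n v * ratioQuotient p h n v * f v) := by
    filter_upwards [eventually_eq_sum_ratioQuotient (h := h) hp n le_rfl] with v hv
    rw [hv, if_neg h0, mul_add, Finset.mul_sum]
    congr 1
    · exact Finset.sum_congr rfl fun _ _ => by ring
    · ring
  rw [taylorCoeffZero_congr j h1, taylorCoeffZero_add, taylorCoeffZero_pow_mul_of_lt hj hr,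
    add_zero, taylorCoeffZero_sum]
  · simp only [taylorCoeffZero_const_mul]
  · exact fun k hk => analyticAt_const.mul (hpf k hk)
  · exact Finset.analyticAt_fun_sum _ fun k hk => analyticAt_const.mul (hpf k hk)
  · exact (analyticAt_id.pow n).mul hr

end Expansion

/-! ### Evaluation of the nested contour integrals -/

/-- For `w ≠ 0`, partial fractions `1/(x(x-w)) = w⁻¹ (1/(x-w) - 1/x)` reduce to Cauchy's formula at
`w` and at `0`. For `w = 0` this is Cauchy's formula for the derivative. -/
theorem circleIntegral_div_mul_sub_eq_dslope {φ : ℂ → ℂ} {r : ℝ} (hr : 0 < r)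
    (hφ : DifferentiableOn ℂ φ (Metric.closedBall 0 r)) {w : ℂ} (hw : ‖w‖ < r) :
    (∮ x in C(0, r), φ x / (x * (x - w))) = 2 * Real.pi * Complex.I * dslope φ 0 w := by
  have hx0 : ∀ x ∈ Metric.sphere (0 : ℂ) r, x ≠ 0 := by
    rintro x hx rfl
    simp at hx
    exact hr.ne hx
  by_cases h0 : w = 0
  · subst h0
    rw [dslope_same, ← smul_eq_mul (2 * Real.pi * Complex.I : ℂ),
      ← hφ.deriv_eq_smul_circleIntegral hr]
    refine circleIntegral.integral_congr hr.le fun x hx => ?_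
    have := hx0 x hx
    simp only [sub_zero, smul_eq_mul]
    field_simp
  · have hxw : ∀ x ∈ Metric.sphere (0 : ℂ) r, x - w ≠ 0 := by
      intro x hx h
      rw [sub_eq_zero] at h
      subst h
      simp at hx
      exact hw.ne hx
    have hc : ContinuousOn φ (Metric.sphere 0 r) :=
      hφ.continuousOn.mono Metric.sphere_subset_closedBall
    have h1 := hφ.circleIntegral_sub_inv_smul (w := w) (by simpa using hw)
    have h2 := hφ.circleIntegral_sub_inv_smul (w := 0) (by simpa using hr)
    have h3 : (∮ x in C(0, r), φ x / (x * (x - w))) =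
        ∮ x in C(0, r), w⁻¹ * ((x - w)⁻¹ • φ x - (x - 0)⁻¹ • φ x) := by
      refine circleIntegral.integral_congr hr.le fun x hx => ?_
      have h4 := hx0 x hx
      have h5 := hxw x hx
      simp only [sub_zero, smul_eq_mul]
      field_simp
      ring
    rw [h3, circleIntegral.integral_const_mul, circleIntegral.integral_sub, h1, h2,
      dslope_of_ne _ h0, slope_def_field, smul_eq_mul, smul_eq_mul, sub_zero]
    · field_simp
    · exact (((continuousOn_id.sub continuousOn_const).inv₀ hxw).smul hc).circleIntegrable hr.le
    · exact (((continuousOn_id.sub continuousOn_const).inv₀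
        (by simpa using hx0)).smul hc).circleIntegrable hr.le

section Nested

variable {n : ℕ} {p : ℕ → ℂ → ℂ} {h : ℂ → ℂ} {δ : ℝ}

theorem differentiableOn_ratioQuotient (hδ : 0 < δ) (hh : DifferentiableOn ℂ h (Metric.ball 0 δ))
    (hP : ∀ k < n, DifferentiableOn ℂ (ratioFun p (k + 1)) (Metric.ball 0 δ) ∧
      ∀ v ∈ Metric.ball (0 : ℂ) δ, ratioFun p (k + 1) v ≠ 0) :
    ∀ k ≤ n, DifferentiableOn ℂ (ratioQuotient p h k) (Metric.ball 0 δ)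
  | 0, _ => hh
  | k + 1, hk => by
    have h1 := hP k (by omega)
    exact (Complex.differentiableOn_dslope (Metric.ball_mem_nhds 0 hδ)).2
      ((differentiableOn_ratioQuotient hδ hh hP k (by omega)).div h1.1 h1.2)

theorem kernelIntegrand_succ (l : ℕ) (v : Fin (l + 2) → ℂ) :
    kernelIntegrand p h (l + 2) (l + 1).succ_pos v =
      (v (Fin.last _) * ratioFun p (l + 2) (v (Fin.last _)))⁻¹ *
        (kernelIntegrand p h (l + 1) l.succ_pos (fun i => v i.castSucc) *
          (v (Fin.last l).castSucc - v (Fin.last _))⁻¹) := by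
  have h1 : (∏ i : Fin (l + 2 - 1), (v ⟨i, by omega⟩ - v ⟨i + 1, by omega⟩)) =
      (∏ i : Fin (l + 1 - 1),
        (v (Fin.castSucc ⟨i, by omega⟩) - v (Fin.castSucc ⟨i + 1, by omega⟩))) *
        (v (Fin.last l).castSucc - v (Fin.last _)) :=
    Fin.prod_univ_castSucc (n := l) fun i : Fin (l + 1) => v ⟨i, by omega⟩ - v ⟨i + 1, by omega⟩
  have h2 : (∏ i : Fin (l + 2), v i * ratioFun p (i + 1) (v i)) =
      (∏ i : Fin (l + 1), v i.castSucc * ratioFun p (i + 1) (v i.castSucc)) *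
        (v (Fin.last _) * ratioFun p (l + 2) (v (Fin.last _))) :=
    Fin.prod_univ_castSucc _
  simp only [kernelIntegrand]
  rw [h1, h2]
  have h3 : v ⟨0, (l + 1).succ_pos⟩ = v (Fin.castSucc ⟨0, l.succ_pos⟩) := rfl
  rw [h3]
  simp only [div_eq_mul_inv, mul_inv]
  ring

theorem continuousOn_kernelIntegrand (hh : ContinuousOn h (Metric.ball 0 δ)) {l : ℕ}
    (hP : ∀ k < l, ContinuousOn (ratioFun p (k + 1)) (Metric.ball 0 δ) ∧
      ∀ v ∈ Metric.ball (0 : ℂ) δ, ratioFun p (k + 1) v ≠ 0) (hl : 0 < l)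
    {R : Fin l → ℝ} (hR : R ∈ nestedRadii l) (hRδ : ∀ i, R i < δ) :
    ContinuousOn (kernelIntegrand p h l hl) {v | ∀ i, ‖v i‖ = R i} := by
  have hi : ∀ i : Fin l, ContinuousOn (fun v : Fin l → ℂ => v i) {v | ∀ i, ‖v i‖ = R i} :=
    fun i => (continuous_apply i).continuousOn
  have hm : ∀ i : Fin l, Set.MapsTo (fun v : Fin l → ℂ => v i) {v | ∀ i, ‖v i‖ = R i}
      (Metric.ball 0 δ) := fun i v hv => by
    have := hv i
    simpa [this] using hRδ i
  refine ContinuousOn.div (hh.comp (hi _) (hm _)) (ContinuousOn.mul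
    (continuousOn_finsetProd _ fun i _ => (hi _).sub (hi _))
    (continuousOn_finsetProd _ fun i _ => (hi _).mul ((hP i i.2).1.comp (hi _) (hm _)))) ?_
  intro v hv
  refine mul_ne_zero (Finset.prod_ne_zero_iff.2 fun i _ h0 => ?_)
    (Finset.prod_ne_zero_iff.2 fun i _ => mul_ne_zero (fun h0 => ?_) ((hP i i.2).2 _ (hm i hv)))
  · have h1 : R ⟨i + 1, by omega⟩ < R ⟨i, by omega⟩ := hR.2 (by simp [Fin.lt_def])
    rw [← hv, ← hv, sub_eq_zero.1 h0] at h1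
    exact lt_irrefl _ h1
  · have h1 := hR.1 i
    rw [← hv, h0, norm_zero] at h1
    exact lt_irrefl _ h1

theorem ContinuousOn.torusIntegrable {l : ℕ} {F : (Fin l → ℂ) → ℂ} {R : Fin l → ℝ}
    (hR : ∀ i, 0 ≤ R i) (hF : ContinuousOn F {v | ∀ i, ‖v i‖ = R i}) : TorusIntegrable F 0 R := by
  have h1 : Continuous (torusMap 0 R) := by
    unfold torusMap
    fun_prop
  refine ContinuousOn.integrableOn_compact isCompact_Icc
    (hF.comp_continuous h1 fun θ i => ?_).continuousOn
  simp [torusMap, Complex.norm_exp_ofReal_mul_I, abs_of_nonneg (hR i)]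

/-- The weight `G` in the innermost variable makes the induction close. Once the new innermost
variable `x` is frozen, the only factor linking it to the other variables is `(y - x)⁻¹`, with `y`
the previous innermost one. The induction hypothesis for this weight leaves one Cauchy integral in
`y`, and `‖x‖ < ‖y‖` lets it produce the next quotient at `x`. -/
theorem torusIntegral_kernelIntegrand_mul (hδ : 0 < δ)
    (hh : DifferentiableOn ℂ h (Metric.ball 0 δ)) (l : ℕ)
    (hP : ∀ k < l + 1, DifferentiableOn ℂ (ratioFun p (k + 1)) (Metric.ball 0 δ) ∧
      ∀ v ∈ Metric.ball (0 : ℂ) δ, ratioFun p (k + 1) v ≠ 0)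
    {R : Fin (l + 1) → ℝ} (hR : R ∈ nestedRadii (l + 1)) (hRδ : ∀ i, R i < δ) {G : ℂ → ℂ}
    (hG : ContinuousOn G (Metric.sphere 0 (R (Fin.last l)))) :
    (∯ v in T(0, R), kernelIntegrand p h (l + 1) l.succ_pos v * G (v (Fin.last l))) =
      (2 * Real.pi * Complex.I) ^ l * ∮ x in C(0, R (Fin.last l)),
        ratioQuotient p h l x / ratioFun p (l + 1) x / x * G x := by
  induction l generalizing G with
  | zero =>
    rw [torusIntegral_dim1, pow_zero, one_mul]
    refine circleIntegral.integral_congr (hR.1 0).le fun x hx => ?_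
    simp [kernelIntegrand, ratioQuotient, div_div, mul_comm]
  | succ l ih =>
    have hF : ContinuousOn (fun v : Fin (l + 2) → ℂ =>
        kernelIntegrand p h (l + 2) (l + 1).succ_pos v * G (v (Fin.last (l + 1))))
        {v | ∀ i, ‖v i‖ = R i} := by
      refine (continuousOn_kernelIntegrand hh.continuousOn
        (fun k hk => ⟨(hP k hk).1.continuousOn, (hP k hk).2⟩) _ hR hRδ).mul
        (hG.comp (continuous_apply _).continuousOn fun v hv => ?_)
      simpa using hv (Fin.last _)
    rw [torusIntegral_succAbove (hF.torusIntegrable fun i => (hR.1 i).le) (Fin.last _),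
      ← circleIntegral.integral_const_mul]
    refine circleIntegral.integral_congr (hR.1 _).le fun x hx => ?_
    have hx : ‖x‖ = R (Fin.last _) := by simpa using hx
    have hR' : R ∘ (Fin.last (l + 1)).succAbove ∈ nestedRadii (l + 1) :=
      ⟨fun i => hR.1 _, hR.2.comp_strictMono (Fin.strictMono_succAbove _)⟩
    have hlt : ‖x‖ < R (Fin.last l).castSucc := by
      rw [hx]
      exact hR.2 (Fin.castSucc_lt_last _)
    have hlast : (R ∘ (Fin.last (l + 1)).succAbove) (Fin.last l) = R (Fin.last l).castSucc := by
      simp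
    have hGx : ContinuousOn (fun y => (y - x)⁻¹)
        (Metric.sphere 0 ((R ∘ (Fin.last (l + 1)).succAbove) (Fin.last l))) := by
      refine (continuousOn_id.sub continuousOn_const).inv₀ fun y hy h0 => ?_
      have h1 : y = x := sub_eq_zero.1 h0
      rw [hlast, mem_sphere_zero_iff_norm, h1] at hy
      exact hlt.ne hy
    have key := ih (fun k hk => hP k (by omega)) hR' (fun i => hRδ _) hGx
    rw [hlast] at key
    have hd : DifferentiableOn ℂ (fun y => ratioQuotient p h l y / ratioFun p (l + 1) y)
        (Metric.closedBall 0 (R (Fin.last l).castSucc)) :=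
      ((differentiableOn_ratioQuotient (n := l + 1) hδ hh (fun k hk => hP k (by omega)) l
        (by omega)).div (hP l (by omega)).1 (hP l (by omega)).2).mono
        (Metric.closedBall_subset_ball (hRδ _))
    have hcauchy := circleIntegral_div_mul_sub_eq_dslope (hR.1 _) hd hlt
    have hdiv : (∮ y in C(0, R (Fin.last l).castSucc),
        ratioQuotient p h l y / ratioFun p (l + 1) y / y * (y - x)⁻¹) =
        ∮ y in C(0, R (Fin.last l).castSucc),
        ratioQuotient p h l y / ratioFun p (l + 1) y / (y * (y - x)) := by
      congr 1
      funext y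
      rw [← div_div _ y, div_eq_mul_inv _ (y - x)]
    rw [hdiv, hcauchy] at key
    have hrec : ∀ y : Fin (l + 1) → ℂ,
        kernelIntegrand p h (l + 2) (l + 1).succ_pos ((Fin.last (l + 1)).insertNth x y) *
          G ((Fin.last (l + 1)).insertNth (α := fun _ => ℂ) x y (Fin.last (l + 1))) =
        ((x * ratioFun p (l + 2) x)⁻¹ * G x) *
          (kernelIntegrand p h (l + 1) l.succ_pos y * (y (Fin.last l) - x)⁻¹) := by
      intro y
      rw [kernelIntegrand_succ]
      simp only [Fin.insertNth_last', Fin.snoc_last, Fin.snoc_castSucc]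
      ring
    simp only [hrec]
    rw [torusIntegral_const_mul]
    have hc : (0 : Fin (l + 2) → ℂ) ∘ (Fin.last (l + 1)).succAbove = 0 := rfl
    rw [hc, key, ratioQuotient]
    simp only [div_eq_mul_inv, mul_inv]
    ring

theorem neBot_nhdsWithin_nestedRadii (l : ℕ) : (𝓝[nestedRadii l] (0 : Fin l → ℝ)).NeBot := by
  -- The radii `ε (l - i)` are positive and strictly decreasing in `i < l`, and shrink to `0` with
  -- `ε`.
  have h1 : Tendsto (fun (ε : ℝ) (i : Fin l) => ε * ((l : ℝ) - i)) (𝓝[>] 0) (𝓝 0) := by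
    refine tendsto_pi_nhds.2 fun i => ?_
    have h2 : Tendsto (fun ε : ℝ => ε * ((l : ℝ) - i)) (𝓝 0) (𝓝 (0 * ((l : ℝ) - i))) :=
      (continuous_id.mul continuous_const).tendsto 0
    rw [zero_mul] at h2
    exact h2.mono_left nhdsWithin_le_nhds
  refine Tendsto.neBot (f := fun (ε : ℝ) (i : Fin l) => ε * ((l : ℝ) - i)) (x := 𝓝[>] 0)
    (tendsto_nhdsWithin_iff.2 ⟨h1, ?_⟩)
  filter_upwards [self_mem_nhdsWithin] with ε hε
  have hε : 0 < ε := hε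
  refine ⟨fun i => mul_pos hε ?_, fun i j hij => mul_lt_mul_of_pos_left ?_ hε⟩
  · have : (i : ℝ) < l := by exact_mod_cast i.2
    linarith
  · have : ((i : ℕ) : ℝ) < (j : ℕ) := by exact_mod_cast hij
    linarith

theorem nestedCircleIntegral_kernelIntegrand
    (hp : ∀ i, 1 ≤ i → i ≤ n → AnalyticAt ℂ (p i) 0 ∧ p i 0 = 1) (hh : AnalyticAt ℂ h 0) {l : ℕ}
    (hl : l < n) :
    nestedCircleIntegral (kernelIntegrand p h (l + 1) l.succ_pos) = ratioQuotient p h l 0 := by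
  have h1 : ∀ᶠ v in 𝓝 (0 : ℂ), AnalyticAt ℂ h v ∧ ∀ k ∈ Finset.range n,
      AnalyticAt ℂ (ratioFun p (k + 1)) v ∧ ratioFun p (k + 1) v ≠ 0 := by
    refine hh.eventually_analyticAt.and ((Filter.eventually_all_finset _).2 fun k hk => ?_)
    have h2 := analyticAt_ratioFun hp (Finset.mem_range.1 hk)
    exact h2.1.eventually_analyticAt.and
      (h2.1.continuousAt.eventually_ne (y := 0) (by simp [h2.2]))
  obtain ⟨δ, hδ, h3⟩ := Metric.eventually_nhds_iff_ball.1 h1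
  have hd : DifferentiableOn ℂ h (Metric.ball 0 δ) :=
    fun v hv => (h3 v hv).1.differentiableAt.differentiableWithinAt
  have hP : ∀ k < l + 1, DifferentiableOn ℂ (ratioFun p (k + 1)) (Metric.ball 0 δ) ∧
      ∀ v ∈ Metric.ball (0 : ℂ) δ, ratioFun p (k + 1) v ≠ 0 := fun k hk =>
    ⟨fun v hv => ((h3 v hv).2 k (Finset.mem_range.2
        (by omega))).1.differentiableAt.differentiableWithinAt,
      fun v hv => ((h3 v hv).2 k (Finset.mem_range.2 (by omega))).2⟩
  have := neBot_nhdsWithin_nestedRadii (l + 1)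
  refine (tendsto_const_nhds.congr' ?_).limUnder_eq
  have h4 : ∀ᶠ R in 𝓝 (0 : Fin (l + 1) → ℝ), ∀ i, R i < δ :=
    eventually_all.2 fun i => (continuous_apply i).tendsto' _ _ rfl |>.eventually
      (gt_mem_nhds hδ)
  filter_upwards [self_mem_nhdsWithin, nhdsWithin_le_nhds h4] with R hR hRδ
  -- With trivial weight, the last circle integral is Cauchy's formula at `0`, where `P_{l+1}(0) =
  -- 1`.
  have h5 := torusIntegral_kernelIntegrand_mul hδ hd l hP hR hRδ (G := fun _ => 1)
    continuousOn_const
  have h6 : DifferentiableOn ℂ (fun y => ratioQuotient p h l y / ratioFun p (l + 1) y)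
      (Metric.closedBall 0 (R (Fin.last l))) :=
    ((differentiableOn_ratioQuotient (n := l + 1) hδ hd hP l (by omega)).div
      (hP l (by omega)).1 (hP l (by omega)).2).mono (Metric.closedBall_subset_ball (hRδ _))
  have h7 := h6.circleIntegral_sub_inv_smul (w := 0) (by simpa using hR.1 _)
  have h8 : (∮ x in C(0, R (Fin.last l)),
      ratioQuotient p h l x / ratioFun p (l + 1) x / x * 1) =
      ∮ x in C(0, R (Fin.last l)),
        (x - 0)⁻¹ • (ratioQuotient p h l x / ratioFun p (l + 1) x) := by
    congr 1
    funext x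
    rw [sub_zero, smul_eq_mul, mul_one, div_eq_inv_mul _ x]
  rw [h8, h7, (analyticAt_ratioFun hp hl).2] at h5
  simp only [mul_one, div_one, smul_eq_mul] at h5
  rw [h5, pow_succ]
  have := Complex.two_pi_I_ne_zero
  field_simp

end Nested

/-! ### Integration along the contour and separable kernels on `L²` -/

theorem MeasureTheory.Lp.coeFn_sum_ae {α ι E : Type*} {m : MeasurableSpace α} {μ : Measure α}
    [NormedAddCommGroup E] {r : ENNReal} (s : Finset ι) (x : ι → Lp E r μ) :
    ∀ᵐ a ∂μ, (∑ k ∈ s, x k : Lp E r μ) a = ∑ k ∈ s, x k a := by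
  classical
  induction s using Finset.induction_on with
  | empty => exact (Lp.coeFn_zero E r μ).mono fun a ha => by simpa using ha
  | insert k s hk ih =>
    rw [Finset.sum_insert hk]
    filter_upwards [Lp.coeFn_add (x k) (∑ k ∈ s, x k), ih] with a h1 h2
    rw [h1, Pi.add_apply, h2, Finset.sum_insert hk]

namespace SimpleContour

variable (Γ : SimpleContour)

theorem continuousOn_toFun : ContinuousOn Γ.toFun Γ.dom := by
  intro x hx
  -- Absolute continuity is given only between points of `dom`. A point `a` on the left is therefore
  -- sought in `dom`, and `x` itself serves when it is the least element; likewise on the right.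
  obtain ⟨a, ha, ha'⟩ : ∃ a ∈ Γ.dom, Set.Ici a ∈ 𝓝[Γ.dom] x := by
    by_cases h : ∃ a ∈ Γ.dom, a < x
    · obtain ⟨a, ha, hax⟩ := h
      exact ⟨a, ha, nhdsWithin_le_nhds (Ici_mem_nhds hax)⟩
    · push Not at h
      exact ⟨x, hx, mem_of_superset self_mem_nhdsWithin h⟩
  obtain ⟨b, hb, hb'⟩ : ∃ b ∈ Γ.dom, Set.Iic b ∈ 𝓝[Γ.dom] x := by
    by_cases h : ∃ b ∈ Γ.dom, x < b
    · obtain ⟨b, hb, hbx⟩ := h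
      exact ⟨b, hb, nhdsWithin_le_nhds (Iic_mem_nhds hbx)⟩
    · push Not at h
      exact ⟨x, hx, mem_of_superset self_mem_nhdsWithin h⟩
  have h1 : Set.uIcc a b ∈ 𝓝[Γ.dom] x :=
    mem_of_superset (inter_mem ha' hb') Set.Icc_subset_uIcc
  exact ((Γ.locallyAC a ha b hb).continuousOn x
    (mem_of_mem_nhdsWithin hx h1)).mono_of_mem_nhdsWithin h1

/-- The arc length element `|Γ'(t)| dt` on the parameter interval. -/
noncomputable def speedMeasure : Measure ℝ :=
  (volume.restrict Γ.dom).withDensity fun t => (‖deriv Γ.toFun t‖₊ : ENNReal)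

theorem aemeasurable_toFun : AEMeasurable Γ.toFun Γ.speedMeasure :=
  (Γ.continuousOn_toFun.aemeasurable Γ.ordConnected.measurableSet).mono_ac
    (withDensity_absolutelyContinuous _ _)

theorem arcLength_eq_map : Γ.arcLength = Γ.speedMeasure.map Γ.toFun := rfl

variable {Γ} {F G : ℂ → ℂ}

theorem integrable_smul_speed (hF : Integrable F Γ.arcLength) :
    Integrable (fun t => ‖deriv Γ.toFun t‖₊ • F (Γ.toFun t)) (volume.restrict Γ.dom) := by
  rw [arcLength_eq_map] at hF
  exact (integrable_withDensity_iff_integrable_smul (measurable_deriv _).nnnorm).1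
    (hF.comp_aemeasurable Γ.aemeasurable_toFun)

theorem contourIntegrable_of_integrable (hF : Integrable F Γ.arcLength) :
    Γ.ContourIntegrable F := by
  have h1 := integrable_smul_speed hF
  -- This is `du` = unit tangent times `|du|`. Where the derivative vanishes the quotient is `0` by
  -- convention, and both sides are `0`.
  have h2 : (fun t => F (Γ.toFun t) * deriv Γ.toFun t) = fun t =>
      (‖deriv Γ.toFun t‖₊ • F (Γ.toFun t)) * (deriv Γ.toFun t / ‖deriv Γ.toFun t‖) := by
    funext t
    by_cases h0 : deriv Γ.toFun t = 0
    · simp [h0]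
    · have h3 : (‖deriv Γ.toFun t‖ : ℂ) ≠ 0 := by simpa using h0
      rw [NNReal.smul_def, Complex.real_smul, coe_nnnorm]
      field_simp
  refine Integrable.congr' h1 ?_ (Eventually.of_forall fun t => ?_)
  · rw [h2]
    refine h1.aestronglyMeasurable.mul (Measurable.aestronglyMeasurable ?_)
    exact (measurable_deriv _).div (Complex.measurable_ofReal.comp (measurable_deriv _).norm)
  · simp [NNReal.smul_def, mul_comm]

theorem norm_setIntegral_mul_deriv_le (hF : Integrable F Γ.arcLength) :
    ‖∫ t in Γ.dom, F (Γ.toFun t) * deriv Γ.toFun t‖ ≤ ∫ u, ‖F u‖ ∂Γ.arcLength := by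
  have h1 : ∫ u, ‖F u‖ ∂Γ.arcLength =
      ∫ t in Γ.dom, ‖F (Γ.toFun t) * deriv Γ.toFun t‖ := by
    have h2 := hF.aestronglyMeasurable.norm
    rw [arcLength_eq_map] at h2 ⊢
    rw [integral_map Γ.aemeasurable_toFun h2, speedMeasure,
      integral_withDensity_eq_integral_smul (measurable_deriv _).nnnorm]
    simp [NNReal.smul_def, mul_comm]
  rw [h1]
  exact norm_integral_le_integral_norm _

/-- Arc length does not see parameters with zero derivative, but there both integrands vanish. -/
theorem integral_congr_ae (h : F =ᵐ[Γ.arcLength] G) : Γ.integral F = Γ.integral G := by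
  have h1 := ae_of_ae_map Γ.aemeasurable_toFun h
  rw [speedMeasure, ae_withDensity_iff (measurable_deriv _).nnnorm.coe_nnreal_ennreal] at h1
  unfold SimpleContour.integral
  congr 1
  refine MeasureTheory.integral_congr_ae (h1.mono fun t ht => ?_)
  by_cases h0 : deriv Γ.toFun t = 0
  · simp [h0]
  · simp [ht (by simpa using h0)]

theorem integral_congr_of_eqOn_carrier (h : Set.EqOn F G Γ.carrier) :
    Γ.integral F = Γ.integral G := by
  unfold SimpleContour.integral
  congr 1
  exact setIntegral_congr_fun Γ.ordConnected.measurableSet fun t ht => by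
    simp only [h ⟨t, ht, rfl⟩]

theorem ContourIntegrable.congr (hF : Γ.ContourIntegrable F) (h : Set.EqOn F G Γ.carrier) :
    Γ.ContourIntegrable G :=
  IntegrableOn.congr_fun hF (fun t ht => by simp only [h ⟨t, ht, rfl⟩])
    Γ.ordConnected.measurableSet

theorem ContourIntegrable.sum_const_mul {ι : Type*} [Fintype ι] {F : ι → ℂ → ℂ} (c : ι → ℂ)
    (hF : ∀ k, Γ.ContourIntegrable (F k)) :
    Γ.ContourIntegrable fun u => ∑ k, c k * F k u := by
  have h1 := integrable_finsetSum Finset.univ fun k _ => (hF k).const_mul (c k)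
  simpa only [ContourIntegrable, IntegrableOn, Finset.sum_mul, mul_assoc] using h1

theorem integral_sum_const_mul {ι : Type*} [Fintype ι] {F : ι → ℂ → ℂ} (c : ι → ℂ)
    (hF : ∀ k, Γ.ContourIntegrable (F k)) :
    Γ.integral (fun u => ∑ k, c k * F k u) = ∑ k, c k * Γ.integral (F k) := by
  unfold SimpleContour.integral
  have h1 : (∫ t in Γ.dom, (∑ k, c k * F k (Γ.toFun t)) * deriv Γ.toFun t) =
      ∑ k, c k * ∫ t in Γ.dom, F k (Γ.toFun t) * deriv Γ.toFun t := by
    simp only [← integral_const_mul]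
    rw [← integral_finsetSum _ fun k _ => (hF k).const_mul (c k)]
    simp only [Finset.sum_mul, mul_assoc]
  rw [h1, Finset.mul_sum]
  exact Finset.sum_congr rfl fun _ _ => by ring

theorem integral_add (hF : Γ.ContourIntegrable F) (hG : Γ.ContourIntegrable G) :
    Γ.integral (fun u => F u + G u) = Γ.integral F + Γ.integral G := by
  unfold SimpleContour.integral
  rw [← mul_add, ← MeasureTheory.integral_add hF hG]
  simp only [add_mul]

theorem integral_const_mul (c : ℂ) : Γ.integral (fun u => c * F u) = c * Γ.integral F := by
  unfold SimpleContour.integral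
  simp only [mul_assoc, MeasureTheory.integral_const_mul]
  ring

theorem integrable_mul_of_memLp_two (hF : MemLp F 2 Γ.arcLength) (hG : MemLp G 2 Γ.arcLength) :
    Integrable (fun u => F u * G u) Γ.arcLength :=
  hF.integrable_mul hG

theorem norm_integral_mul_le (hF : MemLp F 2 Γ.arcLength) (hG : MemLp G 2 Γ.arcLength) :
    ‖Γ.integral fun u => F u * G u‖ ≤ ‖(2 * Real.pi * Complex.I : ℂ)⁻¹‖ *
      ((eLpNorm F 2 Γ.arcLength).toReal * (eLpNorm G 2 Γ.arcLength).toReal) := by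
  unfold SimpleContour.integral
  rw [norm_mul]
  refine mul_le_mul_of_nonneg_left ?_ (norm_nonneg _)
  have hi := integrable_mul_of_memLp_two hF hG
  refine (norm_setIntegral_mul_deriv_le hi).trans ?_
  rw [integral_norm_eq_lintegral_enorm hi.aestronglyMeasurable, ← eLpNorm_one_eq_lintegral_enorm,
    ← ENNReal.toReal_mul]
  have h1 : eLpNorm (F • G) 1 Γ.arcLength ≤
      eLpNorm F 2 Γ.arcLength * eLpNorm G 2 Γ.arcLength :=
    eLpNorm_smul_le_mul_eLpNorm hG.1 hF.1
  exact ENNReal.toReal_mono (ENNReal.mul_ne_top hF.2.ne hG.2.ne) h1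

/-- The bounded functional `φ ↦ ∫_Γ b(u) φ(u) du / (2πi)` on `L²(Γ, |du|)`. -/
noncomputable def pairing (b : ℂ → ℂ) (hb : MemLp b 2 Γ.arcLength) :
    Lp ℂ 2 Γ.arcLength →L[ℂ] ℂ :=
  LinearMap.mkContinuous
    { toFun := fun φ => Γ.integral fun u => b u * φ u
      map_add' := fun φ ψ => by
        rw [← integral_add (contourIntegrable_of_integrable
            (integrable_mul_of_memLp_two hb (Lp.memLp φ)))
          (contourIntegrable_of_integrable (integrable_mul_of_memLp_two hb (Lp.memLp ψ)))]
        refine integral_congr_ae ((Lp.coeFn_add φ ψ).mono fun u hu => ?_)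
        simp only [hu, Pi.add_apply, mul_add]
      map_smul' := fun c φ => by
        rw [RingHom.id_apply, smul_eq_mul, ← integral_const_mul]
        refine integral_congr_ae ((Lp.coeFn_smul c φ).mono fun u hu => ?_)
        simp only [hu, Pi.smul_apply, smul_eq_mul]
        ring }
    (‖(2 * Real.pi * Complex.I : ℂ)⁻¹‖ * (eLpNorm b 2 Γ.arcLength).toReal) fun φ => by
      refine (norm_integral_mul_le hb (Lp.memLp φ)).trans_eq ?_
      rw [Lp.norm_def]
      ring

theorem pairing_apply (b : ℂ → ℂ) (hb : MemLp b 2 Γ.arcLength) (φ : Lp ℂ 2 Γ.arcLength) :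
    pairing b hb φ = Γ.integral fun u => b u * φ u := rfl

theorem pairing_toLp {b q : ℂ → ℂ} (hb : MemLp b 2 Γ.arcLength) (hq : MemLp q 2 Γ.arcLength) :
    pairing b hb (hq.toLp q) = Γ.integral fun u => b u * q u :=
  (pairing_apply b hb _).trans
    (integral_congr_ae (hq.coeFn_toLp.mono fun u hu => congrArg (b u * ·) hu))

/-- The operator with the separable kernel `∑ k, q k u₁ * b k u₂`. -/
theorem hasKernel_finiteRankOperator {m : ℕ} {b q : Fin m → ℂ → ℂ}
    (hb : ∀ k, MemLp (b k) 2 Γ.arcLength) (hq : ∀ k, MemLp (q k) 2 Γ.arcLength)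
    {K : ℂ → ℂ → ℂ} (hK : ∀ u₁, ∀ u₂ ∈ Γ.carrier, K u₁ u₂ = ∑ k, q k u₁ * b k u₂) :
    Γ.HasKernel K (finiteRankOperator (fun k => pairing (b k) (hb k))
      fun k => (hq k).toLp (q k)) := by
  intro φ
  have h1 : ∀ᵐ u ∂Γ.arcLength, ∀ k, (pairing (b k) (hb k) φ • (hq k).toLp (q k)) u =
      pairing (b k) (hb k) φ * q k u := by
    refine ae_all_iff.2 fun k => ?_
    filter_upwards [Lp.coeFn_smul (pairing (b k) (hb k) φ) ((hq k).toLp (q k)),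
      (hq k).coeFn_toLp] with u hu hu'
    rw [hu, Pi.smul_apply, hu', smul_eq_mul]
  have h2 : ∀ᵐ u ∂Γ.arcLength,
      (∑ k, pairing (b k) (hb k) φ • (hq k).toLp (q k) : Lp ℂ 2 Γ.arcLength) u =
        ∑ k, (pairing (b k) (hb k) φ • (hq k).toLp (q k)) u :=
    Lp.coeFn_sum_ae _ _
  filter_upwards [h1, h2] with u₁ h3 h4
  have hi : ∀ k, Γ.ContourIntegrable fun u => b k u * φ u := fun k =>
    contourIntegrable_of_integrable (integrable_mul_of_memLp_two (hb k) (Lp.memLp φ))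
  have hE : Set.EqOn (fun u₂ => ∑ k, q k u₁ * (b k u₂ * φ u₂)) (fun u₂ => K u₁ u₂ * φ u₂)
      Γ.carrier := fun u₂ hu₂ => by
    simp only [hK u₁ u₂ hu₂, Finset.sum_mul, mul_assoc]
  refine ⟨(ContourIntegrable.sum_const_mul _ hi).congr hE, ?_⟩
  rw [← integral_congr_of_eqOn_carrier hE, integral_sum_const_mul _ hi, finiteRankOperator_apply, h4]
  refine Finset.sum_congr rfl fun k _ => ?_
  rw [h3, pairing_apply, mul_comm]

end SimpleContour

/-! ### The residue matrix and the linear system for the coefficients -/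

/-- The matrix `∮₀ v^{i-j-1} p_i(v) f_j(v) dv / (2πi)`, as a matrix of Taylor coefficients. -/
noncomputable def residueMatrix (n : ℕ) (p f : ℕ → ℂ → ℂ) : Matrix (Fin n) (Fin n) ℂ :=
  Matrix.of fun i j =>
    taylorCoeffZero j fun v => v ^ (i : ℕ) * (p (i + 1) v * f (j + 1) v)

section ResidueMatrix

variable {n : ℕ} {p f : ℕ → ℂ → ℂ}

theorem det_residueMatrix (hp : ∀ i, 1 ≤ i → i ≤ n → AnalyticAt ℂ (p i) 0 ∧ p i 0 = 1)
    (hf : ∀ i, 1 ≤ i → i ≤ n → AnalyticAt ℂ (f i) 0 ∧ f i 0 = 1) :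
    (residueMatrix n p f).det = 1 := by
  have ha : ∀ i j : Fin n, AnalyticAt ℂ (fun v => p (i + 1) v * f (j + 1) v) 0 := fun i j =>
    (hp (i + 1) (by omega) (by omega)).1.mul (hf (j + 1) (by omega) (by omega)).1
  rw [Matrix.det_of_isUpperTriangular]
  · refine Finset.prod_eq_one fun i _ => ?_
    have h1 := taylorCoeffZero_pow_add_mul 0 i (ha i i)
    rw [zero_add, taylorCoeffZero_zero, (hp (i + 1) (by omega) (by omega)).2,
      (hf (i + 1) (by omega) (by omega)).2, one_mul] at h1
    exact h1
  · intro i j hij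
    exact taylorCoeffZero_pow_mul_of_lt (by simpa using hij) (ha i j)

theorem contourMatrix_eq (hp : ∀ i, 1 ≤ i → i ≤ n → AnalyticAt ℂ (p i) 0 ∧ p i 0 = 1)
    (hf : ∀ i, 1 ≤ i → i ≤ n → AnalyticAt ℂ (f i) 0 ∧ f i 0 = 1) (Γ : SimpleContour)
    (q g : ℕ → ℂ → ℂ) :
    contourMatrix n Γ p f q g = residueMatrix n p f +
      Matrix.of fun i j : Fin n => Γ.integral fun u => q (i + 1) u * g (j + 1) u := by
  ext i j
  simp only [contourMatrix, residueMatrix, Matrix.of_apply, Matrix.add_apply]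
  congr 1
  have ha : AnalyticAt ℂ (fun v => v ^ (i : ℕ) * (p (i + 1) v * f (j + 1) v)) 0 :=
    (analyticAt_id.pow _).mul ((hp (i + 1) (by omega) (by omega)).1.mul
      (hf (j + 1) (by omega) (by omega)).1)
  refine smallCircleIntegral_eq_taylorCoeffZero ha ?_
  filter_upwards [self_mem_nhdsWithin] with v hv
  have hv : v ≠ 0 := hv
  have h1 : ((i : ℤ) + 1) - ((j : ℤ) + 1) - 1 = (i : ℕ) - ((j + 1 : ℕ) : ℤ) := by
    push_cast
    ring
  rw [h1, zpow_sub₀ hv, zpow_natCast, zpow_natCast]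
  ring

/-- This converts the hypothesis linking `f`, `g` and `H` into the linear system `g = c A` at each
point of the contour. -/
theorem smallCircleIntegral_eq_sum_residueMatrix
    (hp : ∀ i, 1 ≤ i → i ≤ n → AnalyticAt ℂ (p i) 0 ∧ p i 0 = 1)
    (hf : ∀ i, 1 ≤ i → i ≤ n → AnalyticAt ℂ (f i) 0 ∧ f i 0 = 1) {h : ℂ → ℂ}
    (hh : AnalyticAt ℂ h 0) (j : Fin n) :
    smallCircleIntegral (fun v => f (j + 1) v / v ^ ((j : ℕ) + 1) * h v) =
      Matrix.vecMul (fun k : Fin n => ratioQuotient p h k 0) (residueMatrix n p f) j := by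
  have hfj := (hf (j + 1) (by omega) (by omega)).1
  have ha : AnalyticAt ℂ (fun v => f (j + 1) v * h v) 0 := hfj.mul hh
  rw [smallCircleIntegral_eq_taylorCoeffZero ha
    (Eventually.of_forall fun v => by ring : ∀ᶠ v in 𝓝[≠] (0 : ℂ), _),
    taylorCoeffZero_mul_eq_sum hp hh hfj j.2, Finset.sum_range]
  rfl

end ResidueMatrix

/-! ### Separable form of the kernel and conclusion -/

theorem contourKernel_eq_sum {n : ℕ} {p : ℕ → ℂ → ℂ} (q : ℕ → ℂ → ℂ) {H : ℂ → ℂ → ℂ}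
    (hp : ∀ i, 1 ≤ i → i ≤ n → AnalyticAt ℂ (p i) 0 ∧ p i 0 = 1) (u₁ : ℂ) {u₂ : ℂ}
    (hH : AnalyticAt ℂ (fun v => H v u₂) 0) :
    contourKernel n p q H u₁ u₂ =
      ∑ k : Fin n, q (k + 1) u₁ * ratioQuotient p (fun v => H v u₂) k 0 := by
  rw [contourKernel, Finset.sum_range]
  exact Finset.sum_congr rfl fun k _ => by rw [nestedCircleIntegral_kernelIntegrand hp hH k.2]

theorem proposition1p2 (n : ℕ) (Γ : SimpleContour) (p f q g : ℕ → ℂ → ℂ) (H : ℂ → ℂ → ℂ)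
    (hp : ∀ i, 1 ≤ i → i ≤ n → AnalyticAt ℂ (p i) 0 ∧ p i 0 = 1)
    (hf : ∀ i, 1 ≤ i → i ≤ n → AnalyticAt ℂ (f i) 0 ∧ f i 0 = 1)
    (hq : ∀ i, 1 ≤ i → i ≤ n → ContinuousOn (q i) Γ.carrier ∧ MemLp (q i) 2 Γ.arcLength)
    (hg : ∀ i, 1 ≤ i → i ≤ n → ContinuousOn (g i) Γ.carrier ∧ MemLp (g i) 2 Γ.arcLength)
    (hH : ∀ u ∈ Γ.carrier, AnalyticAt ℂ (fun v => H v u) 0)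
    (hfgH : ∀ i, 1 ≤ i → i ≤ n → ∀ u ∈ Γ.carrier,
      smallCircleIntegral (fun v => f i v / v ^ i * H v u) = g i u) :
    ∃ T : Lp ℂ 2 Γ.arcLength →L[ℂ] Lp ℂ 2 Γ.arcLength,
      Γ.HasKernel (contourKernel n p q H) T ∧ IsTraceClass T ∧
        HasFredholmDet T (contourMatrix n Γ p f q g).det := by
  set A := residueMatrix n p f with hA
  have hdet : A.det = 1 := det_residueMatrix hp hf
  have hunit : IsUnit A.det := by simp [hdet]
  -- The row vector `g A⁻¹`. Defining it through `g` rather than `H` makes it square integrable at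
  -- once, with no regularity of `H` in `u`; it agrees with the coefficients `c_k` on the contour.
  let b : Fin n → ℂ → ℂ := fun k u => ∑ j, A⁻¹ j k * g (j + 1) u
  have hq' : ∀ k : Fin n, MemLp (q (k + 1)) 2 Γ.arcLength := fun k =>
    (hq (k + 1) (by omega) (by omega)).2
  have hg' : ∀ k : Fin n, MemLp (g (k + 1)) 2 Γ.arcLength := fun k =>
    (hg (k + 1) (by omega) (by omega)).2
  have hb : ∀ k, MemLp (b k) 2 Γ.arcLength := fun k =>
    memLp_finsetSum _ fun j _ => (hg' j).const_mul (A⁻¹ j k)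
  have hbu : ∀ u ∈ Γ.carrier, ∀ k : Fin n, b k u = ratioQuotient p (fun v => H v u) k 0 := by
    intro u hu k
    have h1 : (fun j : Fin n => g (j + 1) u) =
        Matrix.vecMul (fun k : Fin n => ratioQuotient p (fun v => H v u) k 0) A := by
      funext j
      rw [← hfgH (j + 1) (by omega) (by omega) u hu,
        smallCircleIntegral_eq_sum_residueMatrix hp hf (hH u hu) j]
    have h2 : b k u = Matrix.vecMul (fun j : Fin n => g (j + 1) u) A⁻¹ k :=
      Finset.sum_congr rfl fun _ _ => mul_comm _ _
    rw [h2, h1, Matrix.vecMul_vecMul, Matrix.mul_nonsing_inv _ hunit, Matrix.vecMul_one]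
  refine ⟨_, SimpleContour.hasKernel_finiteRankOperator hb hq' fun u₁ u₂ hu₂ => ?_,
    isTraceClass_finiteRankOperator _ _, ?_⟩
  · rw [contourKernel_eq_sum q hp u₁ (hH u₂ hu₂)]
    simp only [hbu u₂ hu₂]
  · set B : Matrix (Fin n) (Fin n) ℂ :=
      Matrix.of fun i j => Γ.integral fun u => q (i + 1) u * g (j + 1) u with hB
    -- Rows are indexed by the functionals `b k` and columns by the vectors `q_{l+1}`, whence the
    -- transpose.
    have h1 : (Matrix.of fun k l : Fin n =>
        SimpleContour.pairing (b k) (hb k) ((hq' l).toLp (q (l + 1)))) = (B * A⁻¹).transpose := by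
      ext k l
      rw [Matrix.of_apply, SimpleContour.pairing_toLp, Matrix.transpose_apply, Matrix.mul_apply]
      have h2 : (fun u => b k u * q (l + 1) u) =
          fun u => ∑ j : Fin n, A⁻¹ j k * (q (l + 1) u * g (j + 1) u) := by
        funext u
        simp only [b, Finset.sum_mul]
        exact Finset.sum_congr rfl fun _ _ => by ring
      rw [h2, SimpleContour.integral_sum_const_mul _ fun j =>
        SimpleContour.contourIntegrable_of_integrable
          (SimpleContour.integrable_mul_of_memLp_two (hq' l) (hg' j))]
      exact Finset.sum_congr rfl fun _ _ => mul_comm _ _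
    have h3 : (contourMatrix n Γ p f q g).det = (1 + (B * A⁻¹).transpose).det := by
      rw [← Matrix.transpose_one, ← Matrix.transpose_add, Matrix.det_transpose,
        contourMatrix_eq hp hf, ← hA, ← hB]
      have h4 : A + B = (1 + B * A⁻¹) * A := by
        rw [add_mul, one_mul, mul_assoc, Matrix.nonsing_inv_mul _ hunit, mul_one]
      rw [h4, Matrix.det_mul, hdet, mul_one]
    rw [h3, ← h1]
    exact hasFredholmDet_finiteRankOperator _ _
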